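/- Let $m$ be normalized Lebesgue measure on the unit circle $\mathbb T$, let $L^2=L^2(\mathbb T,m)$ with inner product $\langle f,g\rangle=\int_{\mathbb T} f\overline g\,dm$, let $H^2\subset L^2$ be the Hardy space (functions whose negatively indexed Fourier coefficients vanish), let $u$ be a nonconstant inner function (a bounded analytic function on the unit disc $\mathbb D$ whose boundary values are unimodular a.e.), let $K_u=H^2\ominus uH^2$, and let $P_u$ be the orthogonal projection of $L^2$ onto $K_u$. Put $k_0=P_u1$ (the reproducing kernel of $K_u$ at $0$), let $C$ be the conjugation $Cf=u\,\overline{zf}$ on $K_u$, let $S_uf=P_u(zf)$ for $f\in K_u$, and for $|\alpha|\le 1$ let $$S_u^\alpha=S_u+\frac{\alpha}{1-\alpha\overline{u(0)}}\,k_0\otimes Ck_0,\qquad (f\otimes g)h=\langle h,g\rangle f .$$ For $\Phi\in L^2$ let $A_\Phi$ be the operator $f\mapsto P_u(\Phi f)$ defined on the bounded functions in $K_u$. A bounded operator $A$ on $K_u$ is called a bounded truncated Toeplitz operator (TTO) with symbol $\Phi$ if $Af=A_\Phi f$ for all bounded $f\in K_u$. Let $\alpha\in\mathbb C$ with $|\alpha|\le1$,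 and let $A$ be a bounded operator on $K_u$. (1) If $A$ commutes with $S_u^\alpha$, then $A$ is a bounded TTO, and $\varphi+\alpha\,\overline{S_uC\varphi}$ is a symbol of $A$, where $\varphi=\bigl(1-\alpha\overline{u(0)}\bigr)^{-1}Ak_0$. (2) If $A$ commutes with $(S_u^\alpha)^*$, then $A$ is a bounded TTO, and there are $\psi\in K_u$ and $c\in\mathbb C$ such that $\overline\alpha\,\psi+\overline{S_uC\psi}+c$ is a symbol of $A$. -/

import Mathlib

open MeasureTheory AddCircle
open scoped ENNReal ComplexConjugate InnerProductSpace

noncomputable section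

namespace TruncToeplitz

/-- Normalized Lebesgue measure `m` on the unit circle. The circle is parametrized by
`UnitAddCircle = ℝ/ℤ` through `t ↦ exp (2πit)`, which is the function `fourier 1`. -/
abbrev circleMeasure : Measure UnitAddCircle := haarAddCircle

/-- `L²` of the circle. -/
abbrev L2 : Type := Lp ℂ 2 circleMeasure

/-- `L^∞` of the circle. -/
abbrev LInf : Type := Lp ℂ ∞ circleMeasure

/-- Pointwise multiplication `f ↦ φ f` on `L²` by a bounded function `φ`. -/
def mulL (φ : LInf) : L2 →L[ℂ] L2 :=
  (ContinuousLinearMap.mul ℂ ℂ).holderL circleMeasure ∞ 2 2 φ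

/-- The coordinate function `z` on the circle, as an element of `L^∞`. -/
def coordZ : LInf := fourierLp ∞ 1

/-- The Hardy space `H²`: the functions in `L²` whose negatively indexed Fourier coefficients all
vanish. -/
def hardySpace : Submodule ℂ L2 where
  carrier := {f | ∀ n : ℤ, n < 0 → fourierCoeff f n = 0}
  add_mem' := by
    intro f g hf hg n hn
    have hf' := hf n hn
    have hg' := hg n hn
    rw [← fourierBasis_repr] at hf' hg' ⊢
    simp [hf', hg']
  zero_mem' := by
    intro n _
    rw [← fourierBasis_repr]
    simp
  smul_mem' := by
    intro c f hf n hn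
    have hf' := hf n hn
    rw [← fourierBasis_repr] at hf' ⊢
    simp [hf']

theorem isClosed_hardySpace : IsClosed (hardySpace : Set L2) := by
  have h : (hardySpace : Set L2) =
      ⋂ n : ℤ, ⋂ _ : n < 0, {f : L2 | ⟪(fourierLp 2 n : L2), f⟫_ℂ = 0} := by
    ext f
    simp only [Set.mem_iInter, Set.mem_ofPred_eq]
    refine forall₂_congr fun n _ => ?_
    rw [← fourierBasis_repr, HilbertBasis.repr_apply_apply, coe_fourierBasis]
  rw [h]
  exact isClosed_iInter fun n => isClosed_iInter fun _ =>
    isClosed_eq (continuous_const.inner continuous_id) continuous_const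

/-- The value at a point `w` of the open unit disc of (the holomorphic extension of) a function
`f` in the Hardy space with boundary values `f`, given by the Cauchy integral
`∫ f(ζ) / (1 - w ζ̄) dm(ζ)`. -/
def discValue (f : UnitAddCircle → ℂ) (w : ℂ) : ℂ :=
  ∫ t, f t / (1 - w * conj (fourier 1 t : ℂ)) ∂circleMeasure

/-- `u` is (the boundary function of) an inner function: a bounded analytic function with
unimodular boundary values almost everywhere. -/
structure IsInner (u : LInf) : Prop where
  analytic : ∀ n : ℤ, n < 0 → fourierCoeff u n = 0
  unimodular : ∀ᵐ t ∂circleMeasure, ‖u t‖ = 1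

/-- `u` is not (almost everywhere equal to) a constant function. -/
def Nonconstant (u : LInf) : Prop :=
  ¬ ∃ c : ℂ, ∀ᵐ t ∂circleMeasure, u t = c

/-- The model space `K_u = H² ⊖ u H²`. -/
def modelSpace (u : LInf) : Submodule ℂ L2 :=
  hardySpace ⊓ (hardySpace.map (mulL u : L2 →ₗ[ℂ] L2))ᗮ

theorem isClosed_modelSpace (u : LInf) : IsClosed (modelSpace u : Set L2) :=
  isClosed_hardySpace.inter (Submodule.isClosed_orthogonal _)

instance instCompleteSpaceModelSpace (u : LInf) : CompleteSpace (modelSpace u) :=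
  (isClosed_modelSpace u).completeSpace_coe

/-- The orthogonal projection `P_u` of `L²` onto the model space. -/
def projU (u : LInf) : L2 →L[ℂ] modelSpace u :=
  (modelSpace u).orthogonalProjectionOnto

/-- The conjugation `C f = u * conj (z f)` on `L²`. -/
def conjL2 (u : LInf) (f : L2) : L2 :=
  mulL u (star (mulL coordZ f))

theorem mulL_coe (φ : LInf) (f : L2) :
    (mulL φ f : UnitAddCircle → ℂ) =ᵐ[circleMeasure] fun t => φ t * f t :=
  (ContinuousLinearMap.mul ℂ ℂ).coeFn_holder (r := 2) φ f

theorem fourierCoeff_eq_inner (f : L2) (n : ℤ) :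
    fourierCoeff f n = ⟪(fourierLp 2 n : L2), f⟫_ℂ := by
  rw [← fourierBasis_repr, HilbertBasis.repr_apply_apply, coe_fourierBasis]

theorem fourierLp_mem_hardySpace {n : ℤ} (hn : 0 ≤ n) : (fourierLp 2 n : L2) ∈ hardySpace := by
  intro m hm
  rw [fourierCoeff_eq_inner]
  exact orthonormal_fourier.2 (by omega)

theorem star_mulL_coordZ_coe (f : L2) :
    (star (mulL coordZ f) : L2) =ᵐ[circleMeasure]
      fun t => conj (fourier 1 t : ℂ) * conj (f t) := by
  filter_upwards [Lp.coeFn_star (mulL coordZ f), mulL_coe coordZ f, coeFn_fourierLp ∞ 1]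
    with t h1 h2 h3
  rw [h1, Pi.star_apply, h2, coordZ, h3, star_mul', RCLike.star_def]

theorem conjL2_coe (u : LInf) (f : L2) :
    (conjL2 u f : L2) =ᵐ[circleMeasure]
      fun t => u t * (conj (fourier 1 t : ℂ) * conj (f t)) := by
  filter_upwards [mulL_coe u (star (mulL coordZ f)), star_mulL_coordZ_coe f] with t h1 h2
  rw [conjL2, h1, h2]

theorem inner_star_eq_zero {f h : L2} (hf : f ∈ hardySpace) (hh : h ∈ hardySpace) :
    ⟪h, (star (mulL coordZ f) : L2)⟫_ℂ = 0 := by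
  rw [← fourierBasis.tsum_inner_mul_inner h]
  refine (tsum_congr fun n => ?_).trans tsum_zero
  rw [coe_fourierBasis]
  rcases lt_or_ge n 0 with hn | hn
  · have h0 := hh n hn
    rw [fourierCoeff_eq_inner] at h0
    rw [← inner_conj_symm, h0]
    simp
  · have h0 := hf (-(n + 1)) (by omega)
    rw [fourierCoeff_eq_inner] at h0
    have h1 : ⟪(fourierLp 2 n : L2), (star (mulL coordZ f) : L2)⟫_ℂ =
        conj ⟪(fourierLp 2 (-(n + 1)) : L2), f⟫_ℂ := by
      rw [L2.inner_def, L2.inner_def, ← integral_conj]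
      refine integral_congr_ae ?_
      filter_upwards [star_mulL_coordZ_coe f, coeFn_fourierLp 2 n,
        coeFn_fourierLp 2 (-(n + 1))] with t a1 a2 a3
      rw [a1, a2, a3]
      simp only [RCLike.inner_apply, map_mul, fourier_neg, fourier_add, Complex.conj_conj]
      ring
    rw [h1, h0]
    simp

theorem conjL2_mem (u : LInf) (hu : IsInner u) {f : L2} (hf : f ∈ modelSpace u) :
    conjL2 u f ∈ modelSpace u := by
  obtain ⟨hf1, hf2⟩ := Submodule.mem_inf.1 hf
  refine Submodule.mem_inf.2 ⟨fun n hn => ?_, ?_⟩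
  · have h0 := (Submodule.mem_orthogonal' _ _).1 hf2 _
      (Submodule.mem_map_of_mem (fourierLp_mem_hardySpace (n := -n - 1) (by omega)))
    rw [fourierCoeff_eq_inner, ← h0, L2.inner_def, L2.inner_def]
    refine integral_congr_ae ?_
    filter_upwards [conjL2_coe u f, mulL_coe u (fourierLp 2 (-n - 1)), coeFn_fourierLp 2 n,
      coeFn_fourierLp 2 (-n - 1)] with t a1 a2 a3 a4
    rw [a1, a3]
    simp only [ContinuousLinearMap.coe_coe]
    rw [a2, a4]
    simp only [RCLike.inner_apply, sub_eq_add_neg, fourier_neg, fourier_add]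
    ring
  · rw [Submodule.mem_orthogonal]
    rintro _ ⟨h, hh, rfl⟩
    rw [← inner_star_eq_zero hf1 hh, L2.inner_def, L2.inner_def]
    refine integral_congr_ae ?_
    filter_upwards [conjL2_coe u f, star_mulL_coordZ_coe f, mulL_coe u h, hu.unimodular]
      with t a1 a2 a3 a4
    simp only [ContinuousLinearMap.coe_coe]
    rw [a1, a2, a3]
    simp only [RCLike.inner_apply, map_mul]
    have h5 : u t * conj (u t) = 1 := by
      rw [Complex.mul_conj, Complex.normSq_eq_norm_sq, a4]
      norm_num
    linear_combination (conj (fourier 1 t : ℂ) * conj (f t) * conj (h t)) * h5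

/-- The conjugation `C f = u * conj (z f)` on the model space. -/
def conjC (u : LInf) (hu : IsInner u) (f : modelSpace u) : modelSpace u :=
  ⟨conjL2 u f, conjL2_mem u hu f.2⟩

/-- The reproducing kernel `k₀ = P_u 1` of the model space at the origin (the Szegő kernel
`1 / (1 - w̄ z)` of the Hardy space at `w = 0` is the constant function `1`). -/
def kernelZero (u : LInf) : modelSpace u :=
  projU u (Lp.const 2 circleMeasure (1 : ℂ))

/-- The compressed shift `S_u f = P_u (z f)` on the model space. -/
def compShift (u : LInf) : modelSpace u →L[ℂ] modelSpace u :=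
  projU u ∘L mulL coordZ ∘L (modelSpace u).subtypeL

/-- The generalized compressed shift
`S_u^α = S_u + α / (1 - α * conj (u 0)) • (k₀ ⊗ C k₀)`,
where `f ⊗ g` is the rank one operator sending `h` to `⟨h, g⟩ f`. -/
def genShift (u : LInf) (hu : IsInner u) (α : ℂ) : modelSpace u →L[ℂ] modelSpace u :=
  compShift u + (α / (1 - α * conj (discValue u 0))) •
    InnerProductSpace.rankOne ℂ (kernelZero u) (conjC u hu (kernelZero u))

/-- The space of bounded functions in the model space. -/
def boundedPart (u : LInf) : Submodule ℂ (modelSpace u) where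
  carrier := {f | MemLp (f : L2) ∞ circleMeasure}
  add_mem' := by
    intro f g hf hg
    exact (MemLp.add hf hg).ae_eq (Lp.coeFn_add (f : L2) (g : L2)).symm
  zero_mem' := by
    exact (MemLp.zero (p := ∞) (μ := circleMeasure) (ε := ℂ)).ae_eq
      (Lp.coeFn_zero ℂ 2 circleMeasure).symm
  smul_mem' := by
    intro c f hf
    exact (MemLp.const_smul hf c).ae_eq (Lp.coeFn_smul c (f : L2)).symm

/-- The truncated Toeplitz operator `A_Φ` with symbol `Φ ∈ L²`: it is defined on the bounded
functions `f` in the model space and sends `f` to `P_u (Φ f)`. -/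
def truncToeplitz (u : LInf) (Φ : L2) (f : boundedPart u) : modelSpace u :=
  projU u (mulL (MemLp.toLp ((f : modelSpace u) : L2) f.2) Φ)

/-- `Φ` is a symbol of the bounded operator `A` on the model space: `A` is the bounded extension
of the densely defined operator `A_Φ`. -/
def HasSymbol (u : LInf) (A : modelSpace u →L[ℂ] modelSpace u) (Φ : L2) : Prop :=
  ∀ f : boundedPart u, A (f : modelSpace u) = truncToeplitz u Φ f

/-- `A` is a bounded truncated Toeplitz operator on the model space. -/
def IsTTO (u : LInf) (A : modelSpace u →L[ℂ] modelSpace u) : Prop :=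
  ∃ Φ : L2, HasSymbol u A Φ

end TruncToeplitz

end

open TruncToeplitz

noncomputable section

namespace TruncToeplitz

open Filter Topology

/-! Write S for `compShift u`, k₀ for `kernelZero u`, and κ = 1 - α·conj u(0), which is nonzero
since |u(0)| < 1. The adjoint S* is the backward shift, and S S* = I - k₀⊗k₀, S C k₀ = -u(0) k₀, so
S_u^α S* = I - κ⁻¹ k₀⊗k₀. If A commutes with S_u^α, composing on the right with S* gives A - S A S*
= φ⊗k₀ + k₀⊗χ, with φ = κ⁻¹ A k₀ and χ = conj(α/κ) S A* C k₀.

Sarason's criterion (`hasSymbol_of_sub_eq`) turns such an identity into the symbol φ + conj χ: on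
bounded functions, the difference between the form of A and that of the symbol is invariant under
applying S* to both arguments, and it tends to 0 along the iterates, so it vanishes. A truncated
Toeplitz operator satisfies A*C = CA, whence χ = conj(α) S C φ, which is (1).

For (2), apply (1) to A* and conjugate the symbol. With ψ = S C φ one has S C ψ = S S* φ = φ - ⟨φ,
k₀⟩ k₀, and conj k₀ = 1 - u(0) conj u; since conj u is a symbol of the zero operator, only a
constant remains. -/

/-- The exponential `z ^ n` as an element of `L²`. -/
abbrev expL2 (n : ℤ) : L2 := fourierLp 2 n

/-- The function `conj z` on the circle, as an element of `L^∞`. -/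
def coordZbar : LInf := fourierLp ∞ (-1)

/-! ### Multiplication by `z` and by `conj z` -/

theorem const_one_eq : (Lp.const 2 circleMeasure (1 : ℂ) : L2) = expL2 0 := by
  refine Lp.ext ?_
  filter_upwards [Lp.coeFn_const (p := 2) (μ := circleMeasure) (1 : ℂ), coeFn_fourierLp 2 0]
    with t a1 a2
  rw [a1, a2]
  simp

theorem coordZ_mulL_coe (f : L2) :
    (mulL coordZ f : UnitAddCircle → ℂ) =ᵐ[circleMeasure] fun t => fourier 1 t * f t := by
  filter_upwards [mulL_coe coordZ f, coeFn_fourierLp ∞ 1] with t a1 a2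
  rw [a1, coordZ, a2]

theorem coordZbar_mulL_coe (f : L2) :
    (mulL coordZbar f : UnitAddCircle → ℂ) =ᵐ[circleMeasure]
      fun t => conj (fourier 1 t : ℂ) * f t := by
  filter_upwards [mulL_coe coordZbar f, coeFn_fourierLp ∞ (-1)] with t a1 a2
  rw [a1, coordZbar, a2, fourier_neg]

theorem fourier_mul_conj (n : ℤ) (t : UnitAddCircle) :
    (fourier n t : ℂ) * conj (fourier n t : ℂ) = 1 := by
  rw [← fourier_neg, ← fourier_add]
  simp

theorem inner_coordZ_mulL (f g : L2) :
    ⟪f, mulL coordZ g⟫_ℂ = ⟪mulL coordZbar f, g⟫_ℂ := by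
  rw [L2.inner_def, L2.inner_def]
  refine integral_congr_ae ?_
  filter_upwards [coordZ_mulL_coe g, coordZbar_mulL_coe f] with t a1 a2
  rw [a1, a2]
  simp only [RCLike.inner_apply, map_mul, Complex.conj_conj]
  ring

theorem coordZ_mulL_coordZbar_mulL (f : L2) : mulL coordZ (mulL coordZbar f) = f := by
  refine Lp.ext ?_
  filter_upwards [coordZ_mulL_coe (mulL coordZbar f), coordZbar_mulL_coe f] with t a1 a2
  rw [a1, a2, ← mul_assoc, fourier_mul_conj, one_mul]

theorem coordZbar_mulL_coordZ_mulL (f : L2) : mulL coordZbar (mulL coordZ f) = f := by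
  refine Lp.ext ?_
  filter_upwards [coordZbar_mulL_coe (mulL coordZ f), coordZ_mulL_coe f] with t a1 a2
  rw [a1, a2, ← mul_assoc, mul_comm (conj _), fourier_mul_conj, one_mul]

theorem inner_coordZ_mulL_left (f g : L2) :
    ⟪mulL coordZ f, g⟫_ℂ = ⟪f, mulL coordZbar g⟫_ℂ := by
  rw [← inner_conj_symm, inner_coordZ_mulL, inner_conj_symm]

theorem inner_coordZ_mulL_coordZ_mulL (f g : L2) :
    ⟪mulL coordZ f, mulL coordZ g⟫_ℂ = ⟪f, g⟫_ℂ := by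
  rw [inner_coordZ_mulL, coordZbar_mulL_coordZ_mulL]

theorem norm_coordZ_mulL (f : L2) : ‖mulL coordZ f‖ = ‖f‖ := by
  rw [@norm_eq_sqrt_re_inner ℂ, @norm_eq_sqrt_re_inner ℂ _ _ _ _ f, inner_coordZ_mulL_coordZ_mulL]

theorem coordZ_mulL_expL2 (n : ℤ) : mulL coordZ (expL2 n) = expL2 (n + 1) := by
  refine Lp.ext ?_
  filter_upwards [coordZ_mulL_coe (expL2 n), coeFn_fourierLp 2 n, coeFn_fourierLp 2 (n + 1)]
    with t a1 a2 a3
  rw [a1, a2, a3, fourier_add, mul_comm]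

theorem coordZbar_mulL_expL2 (n : ℤ) : mulL coordZbar (expL2 n) = expL2 (n - 1) := by
  rw [← coordZbar_mulL_coordZ_mulL (expL2 (n - 1)), coordZ_mulL_expL2, sub_add_cancel]

theorem inner_expL2_self (n : ℤ) : ⟪expL2 n, expL2 n⟫_ℂ = 1 := by
  rw [inner_self_eq_norm_sq_to_K, orthonormal_fourier.1 n]
  simp

theorem inner_expL2_of_ne {m n : ℤ} (h : m ≠ n) : ⟪expL2 m, expL2 n⟫_ℂ = 0 :=
  orthonormal_fourier.2 h

/-! ### The Hardy space -/

theorem mem_hardySpace_iff {f : L2} : f ∈ hardySpace ↔ ∀ n : ℤ, n < 0 → ⟪expL2 n, f⟫_ℂ = 0 :=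
  forall₂_congr fun n _ => by rw [fourierCoeff_eq_inner]

theorem coordZ_mulL_mem_hardySpace {f : L2} (hf : f ∈ hardySpace) :
    mulL coordZ f ∈ hardySpace := by
  rw [mem_hardySpace_iff] at hf ⊢
  intro n hn
  rw [inner_coordZ_mulL, coordZbar_mulL_expL2]
  exact hf _ (by omega)

theorem inner_expL2_zero_coordZ_mulL {f : L2} (hf : f ∈ hardySpace) :
    ⟪expL2 0, mulL coordZ f⟫_ℂ = 0 := by
  rw [inner_coordZ_mulL, coordZbar_mulL_expL2]
  exact mem_hardySpace_iff.1 hf _ (by omega)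

/-- The backward shift `f ↦ (f - f(0)) / z`. -/
def backShift (f : L2) : L2 := mulL coordZbar (f - ⟪expL2 0, f⟫_ℂ • expL2 0)

theorem coordZ_mulL_backShift (f : L2) :
    mulL coordZ (backShift f) = f - ⟪expL2 0, f⟫_ℂ • expL2 0 :=
  coordZ_mulL_coordZbar_mulL _

/-- The index -1 is excluded because the constant term of `f` is removed before dividing by z. -/
theorem inner_expL2_backShift (f : L2) {n : ℤ} (hn : n ≠ -1) :
    ⟪expL2 n, backShift f⟫_ℂ = ⟪expL2 (n + 1), f⟫_ℂ := by
  rw [backShift, ← inner_coordZ_mulL_left, coordZ_mulL_expL2, inner_sub_right, inner_smul_right,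
    inner_expL2_of_ne (by omega), mul_zero, sub_zero]

theorem backShift_mem_hardySpace {f : L2} (hf : f ∈ hardySpace) : backShift f ∈ hardySpace := by
  rw [mem_hardySpace_iff] at hf ⊢
  intro n hn
  rcases eq_or_ne n (-1) with rfl | h
  · rw [backShift, ← inner_coordZ_mulL_left, coordZ_mulL_expL2, inner_sub_right, inner_smul_right]
    simp only [Int.reduceNeg, neg_add_cancel]
    rw [inner_expL2_self, mul_one, sub_self]
  · rw [inner_expL2_backShift f h]
    exact hf _ (by omega)

theorem inner_expL2_backShift_iterate (f : L2) (k n : ℕ) :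
    ⟪expL2 k, backShift^[n] f⟫_ℂ = ⟪expL2 (k + n : ℕ), f⟫_ℂ := by
  induction n generalizing k with
  | zero => simp
  | succ n ih =>
    rw [Function.iterate_succ_apply', inner_expL2_backShift _ (by omega)]
    have := ih (k + 1)
    push_cast at this ⊢
    rw [this]
    congr 2
    ring

theorem coordZ_mulL_iterate_expL2 (n : ℕ) : (mulL coordZ)^[n] (expL2 0) = expL2 n := by
  induction n with
  | zero => rfl
  | succ n ih => rw [Function.iterate_succ_apply', ih, coordZ_mulL_expL2]; norm_cast

theorem coordZ_mulL_iterate_backShift_iterate (f : L2) (n : ℕ) :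
    (mulL coordZ)^[n] (backShift^[n] f) =
      f - ∑ k ∈ Finset.range n, ⟪expL2 k, f⟫_ℂ • expL2 k := by
  induction n with
  | zero => simp
  | succ n ih =>
    rw [Function.iterate_succ_apply, Function.iterate_succ_apply' backShift,
      coordZ_mulL_backShift, Finset.sum_range_succ, ← sub_sub, ← ih]
    have h := inner_expL2_backShift_iterate f 0 n
    rw [zero_add, Nat.cast_zero] at h
    rw [h, ← coordZ_mulL_iterate_expL2 n, ← FunLike.coe_pow_eq_iterate, map_sub, map_smul]

theorem hasSum_expL2 {f : L2} (hf : f ∈ hardySpace) :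
    HasSum (fun k : ℕ => ⟪expL2 k, f⟫_ℂ • expL2 k) f := by
  have h := hasSum_fourier_series_L2 f
  rw [← (Nat.cast_injective (R := ℤ)).hasSum_iff] at h
  · simpa only [Function.comp_def, fourierCoeff_eq_inner] using h
  · intro n hn
    rw [hf n, zero_smul]
    by_contra h0
    exact hn ⟨n.toNat, by simp; omega⟩

theorem tendsto_coordZ_mulL_iterate_backShift_iterate {f : L2} (hf : f ∈ hardySpace) :
    Tendsto (fun n : ℕ => (mulL coordZ)^[n] (backShift^[n] f)) atTop (𝓝 0) := by
  simp only [coordZ_mulL_iterate_backShift_iterate]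
  have h := (hasSum_expL2 hf).tendsto_sum_nat
  simpa using tendsto_const_nhds (x := f).sub h

theorem norm_coordZ_mulL_iterate (f : L2) (n : ℕ) : ‖(mulL coordZ)^[n] f‖ = ‖f‖ := by
  induction n with
  | zero => rfl
  | succ n ih => rw [Function.iterate_succ_apply', norm_coordZ_mulL, ih]

/-- Multiplication by z is isometric, so the norm of the n-th iterate is that of a tail of the
Fourier series of `f`. -/
theorem tendsto_backShift_iterate {f : L2} (hf : f ∈ hardySpace) :
    Tendsto (fun n : ℕ => backShift^[n] f) atTop (𝓝 0) := by
  rw [tendsto_zero_iff_norm_tendsto_zero]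
  have h := tendsto_zero_iff_norm_tendsto_zero.1
    (tendsto_coordZ_mulL_iterate_backShift_iterate hf)
  simpa only [norm_coordZ_mulL_iterate] using h

theorem mulL_mem_hardySpace {u : LInf} (hu : ∀ n : ℤ, n < 0 → fourierCoeff u n = 0) {f : L2}
    (hf : f ∈ hardySpace) : mulL u f ∈ hardySpace := by
  have hu' : ∀ n : ℤ, 0 ≤ n → mulL u (expL2 n) ∈ hardySpace := by
    intro n hn m hm
    rw [← hu (m - n) (by omega)]
    refine integral_congr_ae ?_
    filter_upwards [mulL_coe u (expL2 n), coeFn_fourierLp 2 n] with t a1 a2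
    rw [a1, a2, neg_sub, sub_eq_add_neg, fourier_add, fourier_neg]
    simp only [smul_eq_mul]
    ring
  rw [mem_hardySpace_iff]
  intro n hn
  -- The coefficient of uf at n < 0 is a pairing of f with the conjugate of z·(u z^(-n-1)); both
  -- factors are analytic, so no approximation of f by polynomials is needed.
  rw [← inner_conj_symm, map_eq_zero,
    ← inner_star_eq_zero (hu' (-n - 1) (by omega)) hf, L2.inner_def, L2.inner_def]
  refine integral_congr_ae ?_
  filter_upwards [mulL_coe u f, mulL_coe u (expL2 (-n - 1)), coeFn_fourierLp 2 (-n - 1),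
    coeFn_fourierLp 2 n, star_mulL_coordZ_coe (mulL u (expL2 (-n - 1)))] with t a1 a2 a3 a4 a5
  rw [a1, a5, a2, a3, a4]
  simp only [RCLike.inner_apply, map_mul, sub_eq_add_neg, fourier_neg, fourier_add,
    Complex.conj_conj]
  linear_combination
    -(fourier n t * conj (u t) * conj (f t)) * fourier_mul_conj 1 t

variable {u : LInf}

/-! ### The model space -/

theorem star_expL2_zero : star (expL2 0) = expL2 0 := by
  refine Lp.ext ?_
  filter_upwards [Lp.coeFn_star (expL2 0), coeFn_fourierLp 2 0] with t a1 a2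
  rw [a1, Pi.star_apply, a2]
  simp

theorem star_smul_L2 (c : ℂ) (f : L2) : star (c • f) = conj c • star f := by
  refine Lp.ext ?_
  filter_upwards [Lp.coeFn_star (c • f), Lp.coeFn_smul c f, Lp.coeFn_smul (conj c) (star f),
    Lp.coeFn_star f] with t a1 a2 a3 a4
  rw [a1, a3, Pi.star_apply, a2, Pi.smul_apply, Pi.smul_apply, a4, Pi.star_apply]
  simp

theorem star_add_L2 (f g : L2) : star (f + g) = star f + star g := by
  refine Lp.ext ?_
  filter_upwards [Lp.coeFn_star (f + g), Lp.coeFn_add f g, Lp.coeFn_add (star f) (star g),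
    Lp.coeFn_star f, Lp.coeFn_star g] with t a1 a2 a3 a4 a5
  rw [a1, a3, Pi.star_apply, a2, Pi.add_apply, Pi.add_apply, a4, a5, star_add]
  rfl

theorem star_sub_L2 (f g : L2) : star (f - g) = star f - star g := by
  rw [eq_sub_iff_add_eq, ← star_add_L2, sub_add_cancel]

theorem inner_star_star (f g : L2) : ⟪(star f : L2), star g⟫_ℂ = ⟪g, f⟫_ℂ := by
  rw [L2.inner_def, L2.inner_def]
  refine integral_congr_ae ?_
  filter_upwards [Lp.coeFn_star f, Lp.coeFn_star g] with t a1 a2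
  rw [a1, a2]
  simp only [Pi.star_apply, RCLike.star_def, RCLike.inner_apply, Complex.conj_conj]
  ring

theorem mem_modelSpace_iff {f : L2} :
    f ∈ modelSpace u ↔ f ∈ hardySpace ∧ ∀ h ∈ hardySpace, ⟪mulL u h, f⟫_ℂ = 0 := by
  rw [modelSpace, Submodule.mem_inf, Submodule.mem_orthogonal]
  refine and_congr_right fun _ => ⟨fun H h hh => H _ (Submodule.mem_map_of_mem hh), ?_⟩
  rintro H _ ⟨h, hh, rfl⟩
  exact H h hh

theorem inner_smul_left_modelSpace (c : ℂ) (f g : modelSpace u) :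
    ⟪c • f, g⟫_ℂ = conj c * ⟪f, g⟫_ℂ :=
  inner_smul_left f g c

theorem inner_smul_right_modelSpace (c : ℂ) (f g : modelSpace u) :
    ⟪f, c • g⟫_ℂ = c * ⟪f, g⟫_ℂ :=
  inner_smul_right f g c

theorem inner_projU (f : modelSpace u) (g : L2) : ⟪f, projU u g⟫_ℂ = ⟪(f : L2), g⟫_ℂ := by
  rw [Submodule.coe_inner]
  exact Submodule.inner_orthogonalProjectionOnto_eq_of_mem_left f g

theorem projU_coe (f : modelSpace u) : projU u f = f :=
  Submodule.orthogonalProjectionOnto_mem_subspace_eq_self f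

theorem projU_eq_zero {g : L2} (h : ∀ f : modelSpace u, ⟪(f : L2), g⟫_ℂ = 0) : projU u g = 0 :=
  ext_inner_left ℂ fun f => by rw [inner_projU, h, inner_zero_right]

theorem coe_projU_eq {f g : L2} (hf : f ∈ modelSpace u)
    (h : ∀ k : modelSpace u, ⟪(k : L2), g - f⟫_ℂ = 0) : projU u g = ⟨f, hf⟩ := by
  rw [← sub_eq_zero, ← projU_coe ⟨f, hf⟩, ← map_sub]
  exact projU_eq_zero h

theorem inner_modelSpace_mulL (f : modelSpace u) {h : L2} (hh : h ∈ hardySpace) :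
    ⟪(f : L2), mulL u h⟫_ℂ = 0 := by
  rw [← inner_conj_symm, (mem_modelSpace_iff.1 f.2).2 h hh, map_zero]

theorem projU_mulL {h : L2} (hh : h ∈ hardySpace) : projU u (mulL u h) = 0 :=
  projU_eq_zero fun f => inner_modelSpace_mulL f hh

theorem coe_mem_hardySpace (f : modelSpace u) : (f : L2) ∈ hardySpace :=
  (mem_modelSpace_iff.1 f.2).1

theorem mulL_coordZ_comm (φ : LInf) (h : L2) : mulL φ (mulL coordZ h) = mulL coordZ (mulL φ h) := by
  refine Lp.ext ?_
  filter_upwards [mulL_coe φ (mulL coordZ h), coordZ_mulL_coe h, coordZ_mulL_coe (mulL φ h),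
    mulL_coe φ h] with t a1 a2 a3 a4
  rw [a1, a2, a3, a4]
  ring

theorem inner_mulL_mulL (hu : IsInner u) (f g : L2) : ⟪mulL u f, mulL u g⟫_ℂ = ⟪f, g⟫_ℂ := by
  rw [L2.inner_def, L2.inner_def]
  refine integral_congr_ae ?_
  filter_upwards [mulL_coe u f, mulL_coe u g, hu.unimodular] with t a1 a2 a3
  rw [a1, a2]
  simp only [RCLike.inner_apply, map_mul]
  have h5 : u t * conj (u t) = 1 := by
    rw [Complex.mul_conj, Complex.normSq_eq_norm_sq, a3]
    norm_num
  linear_combination (g t * conj (f t)) * h5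

theorem mulL_star_mulL_expL2_zero (hu : IsInner u) :
    mulL u (star (mulL u (expL2 0))) = expL2 0 := by
  refine Lp.ext ?_
  filter_upwards [mulL_coe u (star (mulL u (expL2 0))), Lp.coeFn_star (mulL u (expL2 0)),
    mulL_coe u (expL2 0), hu.unimodular, coeFn_fourierLp 2 0] with t a1 a2 a3 a4 a5
  rw [a1, a2, Pi.star_apply, a3, a5]
  simp only [fourier_zero, mul_one]
  rw [RCLike.star_def, Complex.mul_conj, Complex.normSq_eq_norm_sq, a4]
  norm_num

theorem discValue_zero (u : LInf) : discValue u 0 = ⟪expL2 0, mulL u (expL2 0)⟫_ℂ := by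
  rw [discValue, L2.inner_def]
  refine integral_congr_ae ?_
  filter_upwards [mulL_coe u (expL2 0), coeFn_fourierLp 2 0] with t a1 a2
  rw [a1, a2]
  simp

theorem inner_mulL_expL2_zero (u : LInf) :
    ⟪mulL u (expL2 0), expL2 0⟫_ℂ = conj (discValue u 0) := by
  rw [discValue_zero, inner_conj_symm]

theorem expL2_zero_mem : expL2 0 ∈ hardySpace := fourierLp_mem_hardySpace le_rfl

theorem eq_add_coordZ_mulL_backShift (h : L2) :
    h = ⟪expL2 0, h⟫_ℂ • expL2 0 + mulL coordZ (backShift h) := by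
  rw [coordZ_mulL_backShift]
  abel

theorem kernelZero_mem (hu : IsInner u) :
    expL2 0 - conj (discValue u 0) • mulL u (expL2 0) ∈ modelSpace u := by
  refine mem_modelSpace_iff.2 ⟨sub_mem expL2_zero_mem
    (Submodule.smul_mem _ _ (mulL_mem_hardySpace hu.analytic expL2_zero_mem)), fun h hh => ?_⟩
  rw [inner_sub_right, inner_smul_right, inner_mulL_mulL hu]
  nth_rw 1 [eq_add_coordZ_mulL_backShift h]
  rw [map_add, map_smul, inner_add_left, inner_smul_left, inner_mulL_expL2_zero, mulL_coordZ_comm,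
    ← inner_conj_symm (mulL coordZ _), inner_expL2_zero_coordZ_mulL
      (mulL_mem_hardySpace hu.analytic (backShift_mem_hardySpace hh)), inner_conj_symm]
  simp only [map_zero, add_zero]
  ring

theorem kernelZero_eq (hu : IsInner u) :
    kernelZero u = ⟨expL2 0 - conj (discValue u 0) • mulL u (expL2 0), kernelZero_mem hu⟩ := by
  rw [kernelZero, const_one_eq]
  refine coe_projU_eq _ fun k => ?_
  rw [sub_sub_cancel, inner_smul_right, inner_modelSpace_mulL k expL2_zero_mem, mul_zero]

theorem inner_kernelZero (f : modelSpace u) : ⟪kernelZero u, f⟫_ℂ = ⟪expL2 0, (f : L2)⟫_ℂ := by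
  rw [← inner_conj_symm (kernelZero u), kernelZero, inner_projU, inner_conj_symm, const_one_eq]

/-- Pairing with uh moves z across: zuh lies in uH², hence is orthogonal to `f`, and it vanishes at
0, hence is orthogonal to constants. -/
theorem backShift_mem (hu : IsInner u) {f : L2} (hf : f ∈ modelSpace u) :
    backShift f ∈ modelSpace u := by
  obtain ⟨hf1, hf2⟩ := mem_modelSpace_iff.1 hf
  refine mem_modelSpace_iff.2 ⟨backShift_mem_hardySpace hf1, fun h hh => ?_⟩
  rw [backShift, ← inner_coordZ_mulL_left, inner_sub_right, inner_smul_right, ← mulL_coordZ_comm,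
    hf2 _ (coordZ_mulL_mem_hardySpace hh), mulL_coordZ_comm, ← inner_conj_symm (mulL coordZ _),
    inner_expL2_zero_coordZ_mulL (mulL_mem_hardySpace hu.analytic hh)]
  simp

theorem adjoint_compShift (hu : IsInner u) (f : modelSpace u) :
    ContinuousLinearMap.adjoint (compShift u) f = ⟨backShift f, backShift_mem hu f.2⟩ := by
  refine ext_inner_left ℂ fun g => ?_
  rw [ContinuousLinearMap.adjoint_inner_right, ← inner_conj_symm]
  simp only [compShift, ContinuousLinearMap.comp_apply, Submodule.subtypeL_apply]
  rw [inner_projU, inner_conj_symm, Submodule.coe_inner]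
  simp only [backShift]
  rw [← inner_coordZ_mulL_left, inner_sub_right, inner_smul_right,
    ← inner_conj_symm _ (expL2 0), inner_expL2_zero_coordZ_mulL (coe_mem_hardySpace g)]
  simp

theorem coe_adjoint_compShift (hu : IsInner u) (f : modelSpace u) :
    (ContinuousLinearMap.adjoint (compShift u) f : L2) = backShift f := by
  rw [adjoint_compShift hu]

theorem compShift_adjoint_compShift (hu : IsInner u) (f : modelSpace u) :
    compShift u (ContinuousLinearMap.adjoint (compShift u) f) =
      f - ⟪kernelZero u, f⟫_ℂ • kernelZero u := by
  simp only [compShift, ContinuousLinearMap.comp_apply, Submodule.subtypeL_apply]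
  erw [coe_adjoint_compShift hu]
  rw [coordZ_mulL_backShift, map_sub, projU_coe, map_smul, inner_kernelZero, kernelZero,
    const_one_eq]

/-- Since zf is orthogonal to zuH², projecting it only removes a multiple of u. The explicit formula
shows that S preserves boundedness. -/
theorem coe_compShift (hu : IsInner u) (f : modelSpace u) :
    (compShift u f : L2) =
      mulL coordZ f - ⟪mulL u (expL2 0), mulL coordZ f⟫_ℂ • mulL u (expL2 0) := by
  have hmem : mulL coordZ (f : L2) - ⟪mulL u (expL2 0), mulL coordZ f⟫_ℂ • mulL u (expL2 0) ∈
      modelSpace u := by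
    refine mem_modelSpace_iff.2 ⟨sub_mem (coordZ_mulL_mem_hardySpace (coe_mem_hardySpace f))
      (Submodule.smul_mem _ _ (mulL_mem_hardySpace hu.analytic expL2_zero_mem)), fun h hh => ?_⟩
    rw [inner_sub_right, inner_smul_right, inner_mulL_mulL hu]
    nth_rw 1 [eq_add_coordZ_mulL_backShift h]
    rw [map_add, map_smul, inner_add_left, inner_smul_left, mulL_coordZ_comm,
      inner_coordZ_mulL_coordZ_mulL, (mem_modelSpace_iff.1 f.2).2 _ (backShift_mem_hardySpace hh),
      inner_conj_symm]
    ring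
  have h := coe_projU_eq (g := mulL coordZ (f : L2)) hmem fun k => by
    rw [sub_sub_cancel, inner_smul_right, inner_modelSpace_mulL k expL2_zero_mem, mul_zero]
  simp only [compShift, ContinuousLinearMap.comp_apply, Submodule.subtypeL_apply]
  rw [h]

/-! ### The conjugation -/

theorem coordZ_mulL_conjL2 (f : L2) : mulL coordZ (conjL2 u f) = mulL u (star f) := by
  refine Lp.ext ?_
  filter_upwards [coordZ_mulL_coe (conjL2 u f), conjL2_coe u f, mulL_coe u (star f),
    Lp.coeFn_star f] with t a1 a2 a3 a4
  rw [a1, a2, a3, a4, Pi.star_apply, RCLike.star_def]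
  linear_combination (u t * conj (f t)) * fourier_mul_conj 1 t

/-- Here z·Cf = u·conj f differs from C(S*f) by a multiple of u, which P_u annihilates. -/
theorem compShift_conjC (hu : IsInner u) (f : modelSpace u) :
    compShift u (conjC u hu f) =
      conjC u hu (ContinuousLinearMap.adjoint (compShift u) f) := by
  have h1 : mulL coordZ (conjC u hu f : L2) =
      (conjC u hu (ContinuousLinearMap.adjoint (compShift u) f) : L2) +
        conj ⟪expL2 0, (f : L2)⟫_ℂ • mulL u (expL2 0) := by
    simp only [conjC]
    rw [coordZ_mulL_conjL2, conjL2, coe_adjoint_compShift hu, coordZ_mulL_backShift, star_sub_L2,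
      star_smul_L2, star_expL2_zero, map_sub, map_smul]
    abel
  simp only [compShift, ContinuousLinearMap.comp_apply, Submodule.subtypeL_apply]
  erw [h1]
  rw [map_add, map_smul, projU_coe, projU_mulL expL2_zero_mem, smul_zero, add_zero]
  rfl

/-- From k₀ = 1 - conj(u(0)) u one gets z·Ck₀ = u·conj k₀ = u - u(0), and P_u kills u. -/
theorem compShift_conjC_kernelZero (hu : IsInner u) :
    compShift u (conjC u hu (kernelZero u)) = -discValue u 0 • kernelZero u := by
  have h1 : mulL coordZ (conjC u hu (kernelZero u) : L2) =
      mulL u (expL2 0) - discValue u 0 • expL2 0 := by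
    simp only [conjC]
    rw [coordZ_mulL_conjL2, kernelZero_eq hu, star_sub_L2, star_smul_L2, star_expL2_zero, map_sub,
      map_smul, mulL_star_mulL_expL2_zero hu, Complex.conj_conj]
  simp only [compShift, ContinuousLinearMap.comp_apply, Submodule.subtypeL_apply]
  rw [h1, map_sub, projU_mulL expL2_zero_mem, map_smul, zero_sub, kernelZero, const_one_eq,
    neg_smul]

theorem conjL2_conjL2 (hu : IsInner u) (f : L2) : conjL2 u (conjL2 u f) = f := by
  refine Lp.ext ?_
  filter_upwards [conjL2_coe u (conjL2 u f), conjL2_coe u f, hu.unimodular] with t a1 a2 a3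
  rw [a1, a2]
  have h5 : u t * conj (u t) = 1 := by
    rw [Complex.mul_conj, Complex.normSq_eq_norm_sq, a3]
    norm_num
  simp only [map_mul, Complex.conj_conj]
  linear_combination (f t * u t * conj (u t)) * fourier_mul_conj 1 t + f t * h5

theorem conjC_conjC (hu : IsInner u) (f : modelSpace u) : conjC u hu (conjC u hu f) = f :=
  Subtype.ext (conjL2_conjL2 hu f)

theorem conjC_smul (hu : IsInner u) (c : ℂ) (f : modelSpace u) :
    conjC u hu (c • f) = conj c • conjC u hu f := by
  refine Subtype.ext ?_
  simp only [conjC, conjL2, Submodule.coe_smul]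
  rw [map_smul, star_smul_L2, map_smul]

theorem compShift_conjC_compShift_conjC (hu : IsInner u) (f : modelSpace u) :
    compShift u (conjC u hu (compShift u (conjC u hu f))) =
      f - ⟪kernelZero u, f⟫_ℂ • kernelZero u := by
  rw [compShift_conjC hu f, conjC_conjC, compShift_adjoint_compShift hu]

/-! ### Bounded functions in the model space -/

theorem memLp_top_mulL (φ : LInf) {f : L2} (hf : MemLp f ∞ circleMeasure) :
    MemLp (mulL φ f) ∞ circleMeasure :=
  (MemLp.mul (r := ∞) hf (Lp.memLp φ)).ae_eq (mulL_coe φ f).symm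

theorem memLp_top_sub {f g : L2} (hf : MemLp f ∞ circleMeasure) (hg : MemLp g ∞ circleMeasure) :
    MemLp (f - g : L2) ∞ circleMeasure :=
  (hf.sub hg).ae_eq (Lp.coeFn_sub f g).symm

theorem memLp_top_smul (c : ℂ) {f : L2} (hf : MemLp f ∞ circleMeasure) :
    MemLp (c • f : L2) ∞ circleMeasure :=
  (hf.const_smul c).ae_eq (Lp.coeFn_smul c f).symm

theorem memLp_top_expL2 (n : ℤ) : MemLp (expL2 n) ∞ circleMeasure :=
  (Lp.memLp (fourierLp ∞ n : LInf)).ae_eq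
    ((coeFn_fourierLp ∞ n).trans (coeFn_fourierLp 2 n).symm)

theorem memLp_top_backShift {f : L2} (hf : MemLp f ∞ circleMeasure) :
    MemLp (backShift f) ∞ circleMeasure :=
  memLp_top_mulL _ (memLp_top_sub hf (memLp_top_smul _ (memLp_top_expL2 0)))

theorem kernelZero_mem_boundedPart (hu : IsInner u) : kernelZero u ∈ boundedPart u := by
  change MemLp (kernelZero u : L2) ∞ circleMeasure
  rw [kernelZero_eq hu]
  exact memLp_top_sub (memLp_top_expL2 0) (memLp_top_smul _ (memLp_top_mulL _ (memLp_top_expL2 0)))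

theorem compShift_mem_boundedPart (hu : IsInner u) {f : modelSpace u} (hf : f ∈ boundedPart u) :
    compShift u f ∈ boundedPart u := by
  change MemLp (compShift u f : L2) ∞ circleMeasure
  rw [coe_compShift hu]
  exact memLp_top_sub (memLp_top_mulL _ hf)
    (memLp_top_smul _ (memLp_top_mulL _ (memLp_top_expL2 0)))

theorem inner_compShift_iterate_kernelZero (hu : IsInner u) (g : modelSpace u) (n : ℕ) :
    ⟪(compShift u)^[n] (kernelZero u), g⟫_ℂ = ⟪expL2 n, (g : L2)⟫_ℂ := by
  induction n generalizing g with
  | zero => exact inner_kernelZero g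
  | succ n ih =>
    rw [Function.iterate_succ_apply', ← ContinuousLinearMap.adjoint_inner_right, ih,
      coe_adjoint_compShift hu, inner_expL2_backShift _ (by omega)]
    norm_cast

/-- The functions Sⁿk₀ are bounded, and pairing `g` with them reads off all its Fourier coefficients
of nonnegative index. -/
theorem eq_zero_of_inner_boundedPart (hu : IsInner u) {g : modelSpace u}
    (h : ∀ f ∈ boundedPart u, ⟪f, g⟫_ℂ = 0) : g = 0 := by
  have h1 : ∀ n : ℕ, (compShift u)^[n] (kernelZero u) ∈ boundedPart u := by
    intro n
    induction n with
    | zero => exact kernelZero_mem_boundedPart hu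
    | succ n ih =>
      rw [Function.iterate_succ_apply']
      exact compShift_mem_boundedPart hu ih
  have h2 := hasSum_expL2 (coe_mem_hardySpace g)
  simp only [← inner_compShift_iterate_kernelZero hu, h _ (h1 _), zero_smul] at h2
  exact Subtype.ext (h2.unique hasSum_zero)

theorem ext_inner_boundedPart (hu : IsInner u) {g h : modelSpace u}
    (H : ∀ f ∈ boundedPart u, ⟪f, g⟫_ℂ = ⟪f, h⟫_ℂ) : g = h := by
  rw [← sub_eq_zero]
  refine eq_zero_of_inner_boundedPart hu fun f hf => ?_
  rw [inner_sub_right, H f hf, sub_self]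

/-! ### Symbols of truncated Toeplitz operators -/

theorem mulL_toLp_coe {f : L2} (hf : MemLp f ∞ circleMeasure) (h : L2) :
    mulL (hf.toLp f) h =ᵐ[circleMeasure] fun t => f t * h t := by
  filter_upwards [mulL_coe (hf.toLp f) h, hf.coeFn_toLp] with t a1 a2
  rw [a1, a2]

theorem inner_mulL_toLp {f g : L2} (hf : MemLp f ∞ circleMeasure) (hg : MemLp g ∞ circleMeasure)
    (Φ : L2) : ⟪g, mulL (hf.toLp f) Φ⟫_ℂ = ⟪mulL (hg.toLp g) (star Φ), f⟫_ℂ := by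
  rw [L2.inner_def, L2.inner_def]
  refine integral_congr_ae ?_
  filter_upwards [mulL_toLp_coe hf Φ, mulL_toLp_coe hg (star Φ), Lp.coeFn_star Φ] with t a1 a2 a3
  rw [a1, a2, a3]
  simp only [Pi.star_apply, RCLike.star_def, RCLike.inner_apply, map_mul, Complex.conj_conj]
  ring

theorem inner_mulL_toLp_star_expL2_zero {g : L2} (hg : MemLp g ∞ circleMeasure) (ψ : L2) :
    ⟪mulL (hg.toLp g) (star ψ), expL2 0⟫_ℂ = ⟪g, ψ⟫_ℂ := by
  rw [← inner_mulL_toLp (memLp_top_expL2 0) hg, L2.inner_def, L2.inner_def]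
  refine integral_congr_ae ?_
  filter_upwards [mulL_toLp_coe (memLp_top_expL2 0) ψ, coeFn_fourierLp 2 0] with t a1 a2
  rw [a1, a2, fourier_zero, one_mul]

/-- The constant g(0) removed by the backward shift contributes a multiple of conj ψ, which is
orthogonal to zH². -/
theorem inner_mulL_backShift {g ψ h : L2} (hg : MemLp g ∞ circleMeasure) (hψ : ψ ∈ hardySpace)
    (hh : h ∈ hardySpace) :
    ⟪mulL ((memLp_top_backShift hg).toLp (backShift g)) (star ψ), h⟫_ℂ =
      ⟪mulL (hg.toLp g) (star ψ), mulL coordZ h⟫_ℂ := by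
  have h1 : mulL ((memLp_top_backShift hg).toLp (backShift g)) (star ψ) =
      mulL coordZbar (mulL (hg.toLp g) (star ψ) - ⟪expL2 0, g⟫_ℂ • star ψ) := by
    refine Lp.ext ?_
    filter_upwards [mulL_toLp_coe (memLp_top_backShift hg) (star ψ),
      coordZbar_mulL_coe (g - ⟪expL2 0, g⟫_ℂ • expL2 0),
      Lp.coeFn_sub g (⟪expL2 0, g⟫_ℂ • expL2 0), Lp.coeFn_smul ⟪expL2 0, g⟫_ℂ (expL2 0),
      coeFn_fourierLp 2 0,
      coordZbar_mulL_coe (mulL (hg.toLp g) (star ψ) - ⟪expL2 0, g⟫_ℂ • star ψ),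
      Lp.coeFn_sub (mulL (hg.toLp g) (star ψ)) (⟪expL2 0, g⟫_ℂ • star ψ),
      Lp.coeFn_smul ⟪expL2 0, g⟫_ℂ (star ψ), mulL_toLp_coe hg (star ψ)]
      with t a1 a2 a3 a4 a5 a6 a7 a8 a9
    rw [a1, a6, a7, Pi.sub_apply, a8, a9, Pi.smul_apply, backShift, a2, a3, Pi.sub_apply, a4,
      Pi.smul_apply, a5, fourier_zero]
    simp only [smul_eq_mul]
    ring
  have h2 : ⟪(star ψ : L2), mulL coordZ h⟫_ℂ = 0 := by
    rw [← inner_star_star, star_star, ← inner_conj_symm, map_eq_zero,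
      inner_star_eq_zero hh hψ]
  rw [h1, ← inner_coordZ_mulL, inner_sub_left, inner_smul_left, h2, mul_zero, sub_zero]

theorem inner_truncToeplitz (Φ : L2) (f : boundedPart u) (g : modelSpace u) :
    ⟪g, truncToeplitz u Φ f⟫_ℂ =
      ⟪(g : L2), mulL (MemLp.toLp ((f : modelSpace u) : L2) f.2) Φ⟫_ℂ :=
  inner_projU g _

theorem hasSymbol_iff (hu : IsInner u) {A : modelSpace u →L[ℂ] modelSpace u} {Φ : L2} :
    HasSymbol u A Φ ↔ ∀ f g : boundedPart u, ⟪(g : modelSpace u), A f⟫_ℂ =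
      ⟪((g : modelSpace u) : L2), mulL (MemLp.toLp ((f : modelSpace u) : L2) f.2) Φ⟫_ℂ := by
  constructor
  · intro h f g
    rw [h f, inner_truncToeplitz]
  · intro h f
    refine ext_inner_boundedPart hu fun g hg => ?_
    rw [h f ⟨g, hg⟩, inner_truncToeplitz]

theorem HasSymbol.adjoint (hu : IsInner u) {A : modelSpace u →L[ℂ] modelSpace u} {Φ : L2}
    (h : HasSymbol u A Φ) : HasSymbol u (ContinuousLinearMap.adjoint A) (star Φ) := by
  rw [hasSymbol_iff hu] at h ⊢
  intro f g
  rw [ContinuousLinearMap.adjoint_inner_right, ← inner_conj_symm, h g f, inner_conj_symm,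
    inner_mulL_toLp f.2 g.2, star_star]

/-- The function conj u is a symbol of zero: ⟨conj(u) f, g⟩ = ⟨f, ug⟩ = 0 because f is orthogonal to
uH². -/
theorem HasSymbol.of_sub_eq_smul_star (hu : IsInner u) {A : modelSpace u →L[ℂ] modelSpace u}
    {Φ Ψ : L2} (d : ℂ) (h : HasSymbol u A Φ) (hΨ : Φ = Ψ + d • star (mulL u (expL2 0))) :
    HasSymbol u A Ψ := by
  rw [hasSymbol_iff hu] at h ⊢
  intro f g
  have h1 : ⟪((g : modelSpace u) : L2), mulL (MemLp.toLp ((f : modelSpace u) : L2) f.2)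
      (star (mulL u (expL2 0)))⟫_ℂ = ⟪mulL u ((g : modelSpace u) : L2), (f : modelSpace u)⟫_ℂ := by
    rw [L2.inner_def, L2.inner_def]
    refine integral_congr_ae ?_
    filter_upwards [mulL_toLp_coe f.2 (star (mulL u (expL2 0))),
      Lp.coeFn_star (mulL u (expL2 0)), mulL_coe u (expL2 0), coeFn_fourierLp 2 0,
      mulL_coe u ((g : modelSpace u) : L2)] with t a1 a2 a3 a4 a5
    rw [a1, a2, Pi.star_apply, a3, a4, a5, fourier_zero, RCLike.star_def]
    simp only [RCLike.inner_apply, map_mul, map_one]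
    ring
  rw [h f g, hΨ, map_add, map_smul, inner_add_right, inner_smul_right, h1,
    (mem_modelSpace_iff.1 (f : modelSpace u).2).2 _ (coe_mem_hardySpace _), mul_zero, add_zero]

theorem inner_conjC_conjC (hu : IsInner u) (f g : modelSpace u) :
    ⟪conjC u hu f, conjC u hu g⟫_ℂ = ⟪g, f⟫_ℂ := by
  rw [Submodule.coe_inner, Submodule.coe_inner]
  simp only [conjC, conjL2]
  rw [inner_mulL_mulL hu, inner_star_star, inner_coordZ_mulL_coordZ_mulL]

/-- Bounded truncated Toeplitz operators are complex symmetric with respect to `C`. -/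
theorem HasSymbol.adjoint_conjC (hu : IsInner u) {A : modelSpace u →L[ℂ] modelSpace u} {Φ : L2}
    (h : HasSymbol u A Φ) (f : boundedPart u) :
    ContinuousLinearMap.adjoint A (conjC u hu f) = conjC u hu (A f) := by
  refine ext_inner_boundedPart hu fun g hg => ?_
  rw [ContinuousLinearMap.adjoint_inner_right, ← inner_conj_symm, ← inner_conj_symm g]
  congr 1
  rw [← conjC_conjC hu g, inner_conjC_conjC, conjC_conjC, h f, inner_truncToeplitz,
    h ⟨g, hg⟩, inner_truncToeplitz, L2.inner_def, L2.inner_def]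
  -- Both integrals equal ∫ Φ·z·conj(u)·f·g, which is symmetric in f and g.
  refine integral_congr_ae ?_
  filter_upwards [mulL_toLp_coe f.2 Φ, mulL_toLp_coe hg Φ, conjL2_coe u g,
    conjL2_coe u (f : modelSpace u)] with t a1 a2 a3 a4
  simp only [conjC]
  rw [a1, a2, a3, a4]
  simp only [RCLike.inner_apply, map_mul, Complex.conj_conj]
  ring

/-! ### Sarason's characterization -/

/-- The backward shift on the bounded functions of the model space. -/
def bddBackShift (hu : IsInner u) (f : boundedPart u) : boundedPart u :=
  ⟨⟨backShift (f : modelSpace u), backShift_mem hu (f : modelSpace u).2⟩,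
    memLp_top_backShift f.2⟩

theorem coe_bddBackShift (hu : IsInner u) (f : boundedPart u) :
    (bddBackShift hu f : modelSpace u) =
      ContinuousLinearMap.adjoint (compShift u) (f : modelSpace u) :=
  (adjoint_compShift hu f).symm

theorem coe_bddBackShift_iterate (hu : IsInner u) (f : boundedPart u) (n : ℕ) :
    (((bddBackShift hu)^[n] f : modelSpace u) : L2) = backShift^[n] (f : modelSpace u) := by
  induction n with
  | zero => rfl
  | succ n ih => rw [Function.iterate_succ_apply', Function.iterate_succ_apply', ← ih]; rfl

/-- The sesquilinear form `∫ ψ f ḡ` on the bounded functions of the model space. -/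
def symbolForm (ψ : L2) (f g : boundedPart u) : ℂ :=
  ⟪mulL (MemLp.toLp ((g : modelSpace u) : L2) g.2) (star ψ), ((f : modelSpace u) : L2)⟫_ℂ

theorem symbolForm_bddBackShift (hu : IsInner u) {ψ : L2} (hψ : ψ ∈ hardySpace)
    (f g : boundedPart u) :
    symbolForm ψ (bddBackShift hu f) (bddBackShift hu g) =
      symbolForm ψ f g - ⟪kernelZero u, f⟫_ℂ * ⟪((g : modelSpace u) : L2), ψ⟫_ℂ := by
  refine (inner_mulL_backShift g.2 hψ (backShift_mem_hardySpace (coe_mem_hardySpace _))).trans ?_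
  rw [coordZ_mulL_backShift, inner_sub_right, inner_smul_right,
    inner_mulL_toLp_star_expL2_zero g.2, inner_kernelZero]
  rfl

/-- As ψ is only in L², the form need not be L²-continuous jointly in f and g. Instead the shifts of
g are traded for a factor zⁿ on the other side: g·conj ψ stays fixed in L² while zⁿS*ⁿf, a Fourier
tail, tends to 0. -/
theorem tendsto_symbolForm (hu : IsInner u) {ψ : L2} (hψ : ψ ∈ hardySpace) (f g : boundedPart u) :
    Tendsto (fun n : ℕ => symbolForm ψ ((bddBackShift hu)^[n] f) ((bddBackShift hu)^[n] g))
      atTop (𝓝 0) := by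
  have h1 : ∀ (n : ℕ) (h : L2), h ∈ hardySpace →
      ⟪mulL (MemLp.toLp (((bddBackShift hu)^[n] g : modelSpace u) : L2)
        ((bddBackShift hu)^[n] g).2) (star ψ), h⟫_ℂ =
      ⟪mulL (MemLp.toLp ((g : modelSpace u) : L2) g.2) (star ψ), (mulL coordZ)^[n] h⟫_ℂ := by
    intro n
    induction n with
    | zero => intro h _; rfl
    | succ n ih =>
      intro h hh
      rw [Function.iterate_succ_apply (mulL coordZ), ← ih _ (coordZ_mulL_mem_hardySpace hh)]
      simp only [Function.iterate_succ_apply']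
      exact inner_mulL_backShift ((bddBackShift hu)^[n] g).2 hψ hh
  have h2 := (tendsto_const_nhds (x := mulL (MemLp.toLp ((g : modelSpace u) : L2) g.2)
    (star ψ))).inner (𝕜 := ℂ) (tendsto_coordZ_mulL_iterate_backShift_iterate
      (coe_mem_hardySpace (f : modelSpace u)))
  rw [inner_zero_right] at h2
  refine h2.congr fun n => ?_
  rw [← coe_bddBackShift_iterate hu]
  exact (h1 n _ (coe_mem_hardySpace _)).symm

theorem tendsto_bddBackShift_iterate (hu : IsInner u) (f : boundedPart u) :
    Tendsto (fun n : ℕ => ((bddBackShift hu)^[n] f : modelSpace u)) atTop (𝓝 0) := by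
  rw [tendsto_subtype_rng]
  simp only [coe_bddBackShift_iterate]
  exact tendsto_backShift_iterate (coe_mem_hardySpace (f : modelSpace u))

/-- If `A - S_u A S_u^* = ψ ⊗ k₀ + k₀ ⊗ χ`, then `A` is a truncated Toeplitz operator with symbol
`ψ + χ̄`. -/
theorem hasSymbol_of_sub_eq (hu : IsInner u) {A : modelSpace u →L[ℂ] modelSpace u}
    {ψ χ : modelSpace u}
    (hA : ∀ f, A f - compShift u (A (ContinuousLinearMap.adjoint (compShift u) f)) =
      ⟪kernelZero u, f⟫_ℂ • ψ + ⟪χ, f⟫_ℂ • kernelZero u) :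
    HasSymbol u A ((ψ : L2) + star (χ : L2)) := by
  -- The symbol is split into its analytic and co-analytic halves, since the invariance and decay of
  -- `symbolForm` require an analytic ψ; the second half is handled by exchanging f and g.
  set D : boundedPart u → boundedPart u → ℂ := fun f g =>
    ⟪(g : modelSpace u), A f⟫_ℂ - symbolForm (ψ : L2) f g - conj (symbolForm (χ : L2) g f) with hD
  have hstep : ∀ f g, D (bddBackShift hu f) (bddBackShift hu g) = D f g := by
    intro f g
    simp only [hD]
    rw [symbolForm_bddBackShift hu (coe_mem_hardySpace ψ),
      symbolForm_bddBackShift hu (coe_mem_hardySpace χ), coe_bddBackShift, coe_bddBackShift,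
      ContinuousLinearMap.adjoint_inner_left]
    have h := congrArg (fun x => ⟪(g : modelSpace u), x⟫_ℂ) (hA f)
    simp only [inner_sub_right, inner_add_right, inner_smul_right_modelSpace] at h
    simp only [map_sub, map_mul, inner_conj_symm, ← Submodule.coe_inner]
    have hk : conj ⟪kernelZero u, (g : modelSpace u)⟫_ℂ = ⟪(g : modelSpace u), kernelZero u⟫_ℂ :=
      inner_conj_symm (g : modelSpace u) (kernelZero u)
    linear_combination -h + ⟪χ, (f : modelSpace u)⟫_ℂ * hk
  have hiter : ∀ (n : ℕ) f g,
      D ((bddBackShift hu)^[n] f) ((bddBackShift hu)^[n] g) = D f g := by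
    intro n
    induction n with
    | zero => intro f g; rfl
    | succ n ih => intro f g; rw [Function.iterate_succ_apply, Function.iterate_succ_apply, ih, hstep]
  have hzero : ∀ f g, D f g = 0 := by
    intro f g
    have h1 : Tendsto (fun n : ℕ => D ((bddBackShift hu)^[n] f) ((bddBackShift hu)^[n] g))
        atTop (𝓝 0) := by
      have h2 := ((tendsto_bddBackShift_iterate hu g).inner (𝕜 := ℂ)
        ((A.continuous.tendsto 0).comp (tendsto_bddBackShift_iterate hu f)))
      have h3 := tendsto_symbolForm hu (coe_mem_hardySpace ψ) f g
      have h4 := (Complex.continuous_conj.tendsto 0).comp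
        (tendsto_symbolForm hu (coe_mem_hardySpace χ) g f)
      have h5 := (h2.sub h3).sub h4
      simp only [map_zero, inner_zero_left, sub_zero] at h5
      exact h5
    simp only [hiter] at h1
    exact tendsto_nhds_unique tendsto_const_nhds h1
  rw [hasSymbol_iff hu]
  intro f g
  have h := hzero f g
  simp only [hD, symbolForm] at h
  rw [inner_conj_symm, ← inner_mulL_toLp f.2 g.2] at h
  rw [map_add, inner_add_right]
  linear_combination h

/-! ### Commutants of the generalized compressed shifts -/

/-- Vanishing would force |u(0)| ≥ 1, while ‖u - u(0)‖² = 1 - |u(0)|², so u would be constant. -/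
theorem one_sub_mul_conj_discValue_ne_zero (hu : IsInner u) (hnc : Nonconstant u) {α : ℂ}
    (hα : ‖α‖ ≤ 1) : 1 - α * conj (discValue u 0) ≠ 0 := by
  intro h0
  set a := discValue u 0 with ha
  have h1 : 1 ≤ ‖a‖ := by
    have : ‖α‖ * ‖a‖ = 1 := by
      rw [← RCLike.norm_conj a, ← norm_mul, ← sub_eq_zero.1 h0, norm_one]
    nlinarith [norm_nonneg a]
  have h2 : ‖mulL u (expL2 0) - a • expL2 0‖ ^ 2 = 1 - ‖a‖ ^ 2 := by
    have h3 : ⟪mulL u (expL2 0) - a • expL2 0, mulL u (expL2 0) - a • expL2 0⟫_ℂ =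
        1 - a * conj a := by
      rw [inner_sub_left, inner_sub_right, inner_sub_right, inner_smul_left, inner_smul_left,
        inner_smul_right, inner_smul_right, inner_mulL_mulL hu, inner_expL2_self,
        inner_mulL_expL2_zero, ← discValue_zero, ← ha]
      ring
    rw [inner_self_eq_norm_sq_to_K, Complex.mul_conj, Complex.normSq_eq_norm_sq] at h3
    exact Complex.ofReal_injective (by push_cast at h3 ⊢; exact h3)
  have h4 : mulL u (expL2 0) - a • expL2 0 = 0 := by
    rw [← norm_eq_zero, ← sq_eq_zero_iff]
    nlinarith [sq_nonneg ‖mulL u (expL2 0) - a • expL2 0‖]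
  rw [sub_eq_zero] at h4
  refine hnc ⟨a, ?_⟩
  filter_upwards [mulL_coe u (expL2 0), Lp.coeFn_smul a (expL2 0), coeFn_fourierLp 2 0]
    with t a1 a2 a3
  rw [h4, a2, Pi.smul_apply, a3] at a1
  simpa using a1.symm

theorem genShift_apply (hu : IsInner u) (α : ℂ) (f : modelSpace u) :
    genShift u hu α f = compShift u f + (α / (1 - α * conj (discValue u 0)) *
      ⟪conjC u hu (kernelZero u), f⟫_ℂ) • kernelZero u := by
  simp [genShift, mul_smul]

/-- The rank one term contributes through S C k₀ = -u(0) k₀, and 1 + α·conj u(0)/κ = 1/κ for κ = 1 -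
α·conj u(0). -/
theorem genShift_adjoint_compShift (hu : IsInner u) {α : ℂ}
    (hc : 1 - α * conj (discValue u 0) ≠ 0) (f : modelSpace u) :
    genShift u hu α (ContinuousLinearMap.adjoint (compShift u) f) =
      f - ((1 - α * conj (discValue u 0))⁻¹ * ⟪kernelZero u, f⟫_ℂ) • kernelZero u := by
  rw [genShift_apply, compShift_adjoint_compShift hu, ContinuousLinearMap.adjoint_inner_right,
    compShift_conjC_kernelZero, inner_smul_left_modelSpace, sub_add, ← sub_smul]
  congr 2
  rw [map_neg]
  field_simp
  ring

theorem sub_eq_of_commute_genShift (hu : IsInner u) {α : ℂ}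
    (hc : 1 - α * conj (discValue u 0) ≠ 0) {A : modelSpace u →L[ℂ] modelSpace u}
    (hA : A ∘L genShift u hu α = genShift u hu α ∘L A) (f : modelSpace u) :
    A f - compShift u (A (ContinuousLinearMap.adjoint (compShift u) f)) =
      ⟪kernelZero u, f⟫_ℂ • ((1 - α * conj (discValue u 0))⁻¹ • A (kernelZero u)) +
      ⟪conj (α / (1 - α * conj (discValue u 0))) • compShift u
        (ContinuousLinearMap.adjoint A (conjC u hu (kernelZero u))), f⟫_ℂ • kernelZero u := by
  have h := DFunLike.congr_fun hA (ContinuousLinearMap.adjoint (compShift u) f)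
  rw [ContinuousLinearMap.comp_apply, ContinuousLinearMap.comp_apply,
    genShift_adjoint_compShift hu hc, genShift_apply, map_sub, map_smul,
    ← ContinuousLinearMap.adjoint_inner_left A, ContinuousLinearMap.adjoint_inner_right] at h
  rw [inner_smul_left_modelSpace, Complex.conj_conj, smul_smul, mul_comm ⟪kernelZero u, f⟫_ℂ,
    sub_eq_iff_eq_add, add_assoc, ← sub_eq_iff_eq_add', h]
  abel

theorem hasSymbol_of_commute_genShift (hu : IsInner u) {α : ℂ}
    (hc : 1 - α * conj (discValue u 0) ≠ 0) {A : modelSpace u →L[ℂ] modelSpace u}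
    (hA : A ∘L genShift u hu α = genShift u hu α ∘L A) {φ : modelSpace u}
    (hφ : φ = (1 - α * conj (discValue u 0))⁻¹ • A (kernelZero u)) :
    HasSymbol u A
      ((φ : L2) + α • star ((compShift u (conjC u hu φ) : modelSpace u) : L2)) := by
  have h := hasSymbol_of_sub_eq hu (sub_eq_of_commute_genShift hu hc hA)
  -- Complex symmetry is available because a first symbol, written with A*Ck₀, is already known; it
  -- replaces A*Ck₀ by CAk₀.
  rw [h.adjoint_conjC hu ⟨_, kernelZero_mem_boundedPart hu⟩, ← hφ] at h
  convert h using 2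
  rw [hφ, conjC_smul, map_smul, Submodule.coe_smul, Submodule.coe_smul, star_smul_L2,
    star_smul_L2, smul_smul, Complex.conj_conj, Complex.conj_conj, div_eq_mul_inv]

theorem exists_hasSymbol_of_commute_adjoint_genShift (hu : IsInner u) {α : ℂ}
    (hc : 1 - α * conj (discValue u 0) ≠ 0) {A : modelSpace u →L[ℂ] modelSpace u}
    (hA : A ∘L ContinuousLinearMap.adjoint (genShift u hu α) =
      ContinuousLinearMap.adjoint (genShift u hu α) ∘L A) :
    ∃ (ψ : modelSpace u) (c : ℂ),
      HasSymbol u A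
        (conj α • (ψ : L2) +
          star ((compShift u (conjC u hu ψ) : modelSpace u) : L2) +
          Lp.const 2 circleMeasure c) := by
  have hA' : ContinuousLinearMap.adjoint A ∘L genShift u hu α =
      genShift u hu α ∘L ContinuousLinearMap.adjoint A := by
    have h := congrArg ContinuousLinearMap.adjoint hA
    simpa only [ContinuousLinearMap.adjoint_comp, ContinuousLinearMap.adjoint_adjoint] using h.symm
  obtain ⟨φ, hφ⟩ : ∃ φ, φ = (1 - α * conj (discValue u 0))⁻¹ •
      ContinuousLinearMap.adjoint A (kernelZero u) := ⟨_, rfl⟩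
  have h := (hasSymbol_of_commute_genShift hu hc hA' hφ).adjoint hu
  rw [ContinuousLinearMap.adjoint_adjoint] at h
  set ψ := compShift u (conjC u hu φ) with hψ
  -- The discrepancy conj φ - conj(SCψ) is a multiple of conj k₀ = 1 - u(0) conj u: its constant
  -- part is c, its conj u part is discarded.
  refine ⟨ψ, conj ⟪kernelZero u, φ⟫_ℂ, h.of_sub_eq_smul_star hu
    (-(conj ⟪kernelZero u, φ⟫_ℂ * discValue u 0)) ?_⟩
  have hconst : ∀ c : ℂ, (Lp.const 2 circleMeasure c : L2) = c • expL2 0 := fun c => by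
    rw [← const_one_eq]
    simpa using (Lp.constL 2 circleMeasure ℂ : ℂ →L[ℂ] L2).map_smul c 1
  rw [hconst, hψ, compShift_conjC_compShift_conjC, ← hψ, kernelZero_eq hu]
  simp only [Submodule.coe_sub, Submodule.coe_smul]
  simp only [star_add_L2, star_sub_L2, star_smul_L2, star_star, star_expL2_zero,
    Complex.conj_conj]
  module

end TruncToeplitz

end

theorem mainTheorem8 (u : LInf) (hu : IsInner u)
    (hnc : Nonconstant u) (α : ℂ) (hα : ‖α‖ ≤ 1)
    (A : modelSpace u →L[ℂ] modelSpace u) :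
    (A ∘L genShift u hu α = genShift u hu α ∘L A →
      IsTTO u A ∧
      ∀ φ : modelSpace u,
        φ = (1 - α * conj (discValue u 0))⁻¹ • A (kernelZero u) →
        HasSymbol u A
          ((φ : L2) +
            α • star ((compShift u (conjC u hu φ) :
              modelSpace u) : L2))) ∧
    (A ∘L ContinuousLinearMap.adjoint (genShift u hu α) =
        ContinuousLinearMap.adjoint (genShift u hu α) ∘L A →
      IsTTO u A ∧
      ∃ (ψ : modelSpace u) (c : ℂ),
        HasSymbol u A
          (conj α • (ψ : L2) +
            star ((compShift u (conjC u hu ψ) :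
              modelSpace u) : L2) +
            Lp.const 2 circleMeasure c)) := by
  have hc := one_sub_mul_conj_discValue_ne_zero hu hnc hα
  refine ⟨fun hA => ⟨⟨_, hasSymbol_of_commute_genShift hu hc hA rfl⟩,
    fun φ hφ => hasSymbol_of_commute_genShift hu hc hA hφ⟩, fun hA => ?_⟩
  obtain ⟨ψ, c, h⟩ := exists_hasSymbol_of_commute_adjoint_genShift hu hc hA
  exact ⟨⟨_, h⟩, ψ, c, h⟩
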